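/- Let $R$ be a commutative Noetherian ring and let $\Phi$ be a system of ideals of $R$, that is, a non-empty set of ideals such that for all $\mathfrak a_1,\mathfrak a_2\in\Phi$ there is $\mathfrak b\in\Phi$ with $\mathfrak b\subseteq\mathfrak a_1\mathfrak a_2$. For an $R$-module $M$ put $\Gamma_\Phi(M)=\{x\in M : \mathfrak a x=0 \text{ for some } \mathfrak a\in\Phi\}$, and let $H^i_\Phi$ denote the $i$-th right derived functor of the left exact functor $\Gamma_\Phi$ on the category of $R$-modules. Let $N$ be a $\Phi$-torsion $R$-module (that is, $\Gamma_\Phi(N)=N$), let $M$ be an arbitrary $R$-module, let $\mathcal S$ be a Serre subcategory of the category of $R$-modules (a class of modules containing $0$ and closed under submodules, quotients and extensions), and let $s,t\ge 0$ be integers such that (i) $\operatorname{Ext}^{s+t}_R(N,M)\in\mathcal S$; (ii) $\operatorname{Ext}^{s+1+i}_R(N,H^{t-i}_\Phi(M))\in\mathcal S$ for all $i$ with $1\le i\le t$; (iii) $\operatorname{Ext}^{s-1-i}_R(N,H^{t+i}_\Phi(M))\in\mathcal S$ for all $i$ with $1\le i\le s-1$. Then $\operatorname{Ext}^{s}_R(N,H^{t}_\Phi(M))\in\mathcal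 S$. -/

import Mathlib

open CategoryTheory

universe u

/-- A system of ideals of `R`: a non-empty set `Φ` of ideals such that the product of any two
members of `Φ` contains a member of `Φ`. -/
structure SystemOfIdeals (R : Type u) [CommRing R] where
  /-- The underlying set of ideals. -/
  carrier : Set (Ideal R)
  nonempty : carrier.Nonempty
  exists_le_mul : ∀ a ∈ carrier, ∀ b ∈ carrier, ∃ c ∈ carrier, c ≤ a * b

namespace SystemOfIdeals

variable {R : Type u} [CommRing R] (Φ : SystemOfIdeals R)

/-- The submodule `Γ_Φ(M) = {x ∈ M | a x = 0 for some a ∈ Φ}` of `M`. -/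
def torsion (M : Type u) [AddCommGroup M] [Module R M] : Submodule R M where
  carrier := {x | ∃ a ∈ Φ.carrier, ∀ r ∈ a, r • x = 0}
  zero_mem' := by
    obtain ⟨a, ha⟩ := Φ.nonempty
    exact ⟨a, ha, fun r _ => smul_zero r⟩
  add_mem' := by
    rintro x y ⟨a, ha, hx⟩ ⟨b, hb, hy⟩
    obtain ⟨c, hc, hle⟩ := Φ.exists_le_mul a ha b hb
    refine ⟨c, hc, fun r hr => ?_⟩
    have hra : r ∈ a := (hle.trans Ideal.mul_le_left) hr
    have hrb : r ∈ b := (hle.trans Ideal.mul_le_right) hr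
    rw [smul_add, hx r hra, hy r hrb, add_zero]
  smul_mem' := by
    rintro s x ⟨a, ha, hx⟩
    exact ⟨a, ha, fun r hr => by rw [smul_comm, hx r hr, smul_zero]⟩

/-- A module `N` is `Φ`-torsion if `Γ_Φ(N) = N`. -/
def IsTorsion (N : Type u) [AddCommGroup N] [Module R N] : Prop :=
  Φ.torsion N = ⊤

lemma map_mem_torsion {M N : Type u} [AddCommGroup M] [Module R M] [AddCommGroup N] [Module R N]
    (f : M →ₗ[R] N) : ∀ x ∈ Φ.torsion M, f x ∈ Φ.torsion N := by
  rintro x ⟨a, ha, hx⟩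
  exact ⟨a, ha, fun r hr => by rw [← map_smul, hx r hr, map_zero]⟩

/-- The functor `Γ_Φ` from `R`-modules to `R`-modules; on morphisms it is restriction. -/
def torsionFunctor : ModuleCat.{u} R ⥤ ModuleCat.{u} R where
  obj M := ModuleCat.of R (Φ.torsion M)
  map f := ModuleCat.ofHom (f.hom.restrict (Φ.map_mem_torsion f.hom))
  map_id _ := rfl
  map_comp _ _ := rfl

instance : Φ.torsionFunctor.Additive where
  map_add := rfl

/-- The general local cohomology functor `H^i_Φ`, the `i`-th right derived functor of `Γ_Φ`. -/
noncomputable def localCohomology (i : ℕ) : ModuleCat.{u} R ⥤ ModuleCat.{u} R :=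
  Φ.torsionFunctor.rightDerived i

end SystemOfIdeals

/-- The `R`-module `Ext^n_R(N, M)`. -/
noncomputable def extModule {R : Type u} [CommRing R] (n : ℕ) (N M : ModuleCat.{u} R) :
    ModuleCat.{u} R :=
  ModuleCat.of R (Abelian.Ext.{u} N M n)

open Limits

/-! ### Torsion in injective modules -/

namespace SystemOfIdeals

variable {R : Type u} [CommRing R] (Φ : SystemOfIdeals R)

/-! Let `I` be an injective resolution of `M`. Divide the augmented complex `M → I⁰ → I¹ → ⋯`, which
is acyclic, by the subcomplex `0 → Γ_Φ(I⁰) → Γ_Φ(I¹) → ⋯`. The quotient `A` has `A⁰ = M` and `Hⁿ(A)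
= Hⁿ_Φ(M)`. By Artin–Rees `Γ_Φ(Iⁿ)` is injective, so torsion `N` has no `Ext` into `Aⁿ⁺¹ =
Iⁿ/Γ_Φ(Iⁿ)` (`exists_complex`).

There is thus a spectral sequence `Ext^p(N, H^q_Φ(M)) ⇒ Ext^{p+q}(N, M)`; the hypotheses put in `S`
the abutment and all that differentials can link to the entry `(s, t)`. It is unrolled by dimension
shifting: with `Oⁿ` the opcycles and `B` the coboundaries in `Aⁿ⁺¹`, use `0 → Hⁿ → Oⁿ → B → 0` and
`Ext^{p+1}(N, B) ≅ Ext^p(N, Oⁿ⁺¹)`, starting from `O⁰ = M` (`prop_ext_homology`). -/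

lemma exists_le_pow {a : Ideal R} (ha : a ∈ Φ.carrier) (n : ℕ) : ∃ c ∈ Φ.carrier, c ≤ a ^ n := by
  induction n with
  | zero => exact ⟨a, ha, by simp⟩
  | succ n ih =>
    obtain ⟨c, hc, hca⟩ := ih
    obtain ⟨b, hb, hbc⟩ := Φ.exists_le_mul c hc a ha
    exact ⟨b, hb, hbc.trans (by rw [pow_succ]; exact Ideal.mul_mono_left hca)⟩

/-- A finite family of torsion elements is annihilated by a single member of the system. -/
lemma exists_forall_smul_eq_zero {M : Type u} [AddCommGroup M] [Module R M] (s : Finset M)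
    (hs : ∀ x ∈ s, x ∈ Φ.torsion M) : ∃ a ∈ Φ.carrier, ∀ r ∈ a, ∀ x ∈ s, r • x = 0 := by
  classical
  induction s using Finset.induction_on with
  | empty =>
    obtain ⟨a, ha⟩ := Φ.nonempty
    exact ⟨a, ha, by simp⟩
  | insert x s _ ih =>
    obtain ⟨a, ha, has⟩ := ih fun y hy => hs y (Finset.mem_insert_of_mem hy)
    obtain ⟨b, hb, hbx⟩ := hs x (Finset.mem_insert_self x s)
    obtain ⟨c, hc, hcab⟩ := Φ.exists_le_mul a ha b hb
    refine ⟨c, hc, fun r hr y hy => ?_⟩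
    rcases Finset.mem_insert.1 hy with rfl | hy
    · exact hbx r (Ideal.mul_le_right (hcab hr))
    · exact has r (Ideal.mul_le_left (hcab hr)) y hy

/-- The torsion submodule of an injective module over a Noetherian ring is injective. -/
theorem injective_torsion [IsNoetherianRing R] (E : Type u) [AddCommGroup E] [Module R E]
    [hE : Module.Injective R E] : Module.Injective R (Φ.torsion E) := by
  classical
  refine Module.Baer.injective fun I g => ?_
  obtain ⟨a, ha, hag⟩ : ∃ a ∈ Φ.carrier, ∀ r ∈ a, ∀ x : I, r • g x = 0 := by
    obtain ⟨s, hs⟩ := (IsNoetherian.noetherian (⊤ : Submodule R I))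
    obtain ⟨a, ha, h⟩ := Φ.exists_forall_smul_eq_zero (s.image fun x => (g x : E)) (by
      intro x hx
      obtain ⟨y, -, rfl⟩ := Finset.mem_image.1 hx
      exact (g y).2)
    refine ⟨a, ha, fun r hr x => ?_⟩
    have hx : x ∈ Submodule.span R (s : Set I) := hs ▸ Submodule.mem_top
    have hle : Submodule.span R (s : Set I) ≤ LinearMap.ker (r • g) :=
      Submodule.span_le.2 fun y hy => Subtype.ext (h r hr _ (Finset.mem_image_of_mem _ hy))
    exact hle hx
  -- Artin–Rees: `a^(k+1) ⊓ I = a * (a^k ⊓ I) ≤ a * I`, and `g` kills `a * I`.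
  obtain ⟨k, hk⟩ := a.exists_pow_inf_eq_pow_smul (M := R) I
  let b : Ideal R := a ^ (k + 1)
  have hb : b ⊓ I ≤ a • I := by
    have := hk (k + 1) (Nat.le_succ k)
    simp only [Nat.add_sub_cancel_left, pow_one, smul_eq_mul, Ideal.mul_top] at this
    change a ^ (k + 1) ⊓ I ≤ a * I
    rw [this]
    exact Ideal.mul_mono_right inf_le_right
  have hgb : ∀ x (hx : x ∈ I), x ∈ b → g ⟨x, hx⟩ = 0 := by
    intro x hx hxb
    have key : a • I ≤ Submodule.map I.subtype (LinearMap.ker g) := by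
      refine Submodule.smul_le.2 fun r hr y hy => ⟨r • ⟨y, hy⟩, ?_, rfl⟩
      change g (r • _) = 0
      rw [map_smul, hag r hr]
    obtain ⟨y, hy, hyx⟩ := key (hb ⟨hxb, hx⟩)
    have : y = ⟨x, hx⟩ := Subtype.ext hyx
    exact this ▸ hy
  -- The map induced by `g` on the image of `I` in `R ⧸ b` extends to `R ⧸ b`.
  let π : I →ₗ[R] R ⧸ b := b.mkQ.comp I.subtype
  have hπ : LinearMap.ker π ≤ LinearMap.ker ((Φ.torsion E).subtype.comp g) := by
    intro x hx
    have hxb : (x : R) ∈ b := (Submodule.Quotient.mk_eq_zero b).1 hx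
    simp [hgb x x.2 hxb]
  let f : (I ⧸ LinearMap.ker π) →ₗ[R] E := (LinearMap.ker π).liftQ _ hπ
  let i : (I ⧸ LinearMap.ker π) →ₗ[R] R ⧸ b := (LinearMap.ker π).liftQ π le_rfl
  have hi : Function.Injective i := LinearMap.ker_eq_bot.1 (Submodule.ker_liftQ_eq_bot _ _ _ le_rfl)
  obtain ⟨h, hh⟩ := hE.out i hi f
  -- A member of `Φ` inside `b` kills `R ⧸ b`, so the extension has torsion values.
  obtain ⟨c, hc, hcb⟩ := Φ.exists_le_pow ha (k + 1)
  refine ⟨(h.comp b.mkQ).codRestrict _ fun x => ⟨c, hc, fun r hr => ?_⟩, fun x hx => ?_⟩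
  · rw [← map_smul]
    have : b.mkQ (r • x) = 0 :=
      (Submodule.Quotient.mk_eq_zero b).2 (b.mul_mem_right x (hcb hr))
    rw [LinearMap.comp_apply, this, map_zero]
  · exact Subtype.ext (hh (Submodule.Quotient.mk ⟨x, hx⟩))

/-- The inclusion of the torsion functor into the identity functor. -/
def torsionι : Φ.torsionFunctor ⟶ 𝟭 (ModuleCat.{u} R) where
  app M := ModuleCat.ofHom (Φ.torsion M).subtype

instance (M : ModuleCat.{u} R) : Mono (Φ.torsionι.app M) :=
  (ModuleCat.mono_iff_injective _).2 Subtype.val_injective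

instance [IsNoetherianRing R] (E : ModuleCat.{u} R) [Injective E] :
    Injective (Φ.torsionFunctor.obj E) :=
  have : Module.Injective R E := Module.injective_module_of_injective_object R E
  have := Φ.injective_torsion E
  Module.injective_object_of_injective_module R (Φ.torsion E)

lemma exists_torsionι_factor {N : ModuleCat.{u} R} (hN : Φ.IsTorsion N) {M : ModuleCat.{u} R}
    (f : N ⟶ M) : ∃ g : N ⟶ Φ.torsionFunctor.obj M, g ≫ Φ.torsionι.app M = f :=
  ⟨ModuleCat.ofHom (f.hom.codRestrict (Φ.torsion M) fun x =>
    Φ.map_mem_torsion f.hom x (hN ▸ Submodule.mem_top)), rfl⟩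

end SystemOfIdeals

open Abelian in
/-- If `0 ⟶ X₁ ⟶ X₂ ⟶ X₃ ⟶ 0` is exact with `X₁` and `X₂` injective and every morphism
`N ⟶ X₂` factors through `X₁`, then `Ext^n(N, X₃) = 0` for all `n`. -/
lemma ext_eq_zero_of_shortExact_of_injective {R : Type u} [CommRing R] {N : ModuleCat.{u} R}
    {X : ShortComplex (ModuleCat.{u} R)} (hX : X.ShortExact) [Injective X.X₁] [Injective X.X₂]
    (hfac : ∀ f : N ⟶ X.X₂, ∃ g : N ⟶ X.X₁, g ≫ X.f = f) {n : ℕ} (x : Ext.{u} N X.X₃ n) :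
    x = 0 := by
  obtain ⟨y, rfl⟩ := Ext.covariant_sequence_exact₃ N hX x rfl (Ext.eq_zero_of_injective _)
  -- In degree 0 the class factors through `X.f ≫ X.g = 0`; in positive degrees `X.X₂` is injective.
  cases n with
  | zero =>
    obtain ⟨f, rfl⟩ := Ext.addEquiv₀.symm.surjective y
    obtain ⟨g, rfl⟩ := hfac f
    simp
  | succ n => rw [Ext.eq_zero_of_injective y, Ext.zero_comp]

/-! ### Long exact `Ext` sequences modulo a Serre class -/

section Serre

variable {R : Type u} [CommRing R] (S : ObjectProperty (ModuleCat.{u} R)) [S.IsSerreClass]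
  {N : ModuleCat.{u} R} {X : ShortComplex (ModuleCat.{u} R)}

lemma prop_extModule_of_iso {A B : ModuleCat.{u} R} (e : A ≅ B) {n : ℕ}
    (h : S (extModule n N A)) : S (extModule n N B) := by
  refine S.prop_of_iso (LinearEquiv.toModuleIso (LinearEquiv.ofLinearMap
    ((Abelian.Ext.mk₀ e.hom).postcompOfLinear R N (add_zero n))
    ((Abelian.Ext.mk₀ e.inv).postcompOfLinear R N (add_zero n)) ?_ ?_)) h
  all_goals ext x; simp

lemma prop_of_subsingleton (A : ModuleCat.{u} R) [Subsingleton A] : S A :=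
  S.prop_of_isZero (ModuleCat.isZero_of_subsingleton A)

lemma prop_of_linearMap_exact {A B C : Type u} [AddCommGroup A] [AddCommGroup B] [AddCommGroup C]
    [Module R A] [Module R B] [Module R C] (f : A →ₗ[R] B) (g : B →ₗ[R] C)
    (h : Function.Exact f g) (hA : S (ModuleCat.of R A)) (hC : S (ModuleCat.of R C)) :
    S (ModuleCat.of R B) :=
  S.prop_X₂_of_exact (S := ShortComplex.mk (ModuleCat.ofHom f) (ModuleCat.ofHom g) (by
    ext x; exact h.apply_apply_eq_zero x))
    ((ShortComplex.ShortExact.moduleCat_exact_iff_function_exact _).2 h) hA hC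

open Abelian

lemma prop_ext_X₂ (hX : X.ShortExact) {n : ℕ} (h₁ : S (extModule n N X.X₁))
    (h₃ : S (extModule n N X.X₃)) : S (extModule n N X.X₂) :=
  prop_of_linearMap_exact S ((Ext.mk₀ X.f).postcompOfLinear R N (add_zero n))
    ((Ext.mk₀ X.g).postcompOfLinear R N (add_zero n)) (fun x =>
      ⟨fun hx => Ext.covariant_sequence_exact₂ N hX x hx, by rintro ⟨y, rfl⟩; simp⟩) h₁ h₃

lemma prop_ext_X₃ (hX : X.ShortExact) {n : ℕ} (h₂ : S (extModule n N X.X₂))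
    (h₁ : S (extModule (n + 1) N X.X₁)) : S (extModule n N X.X₃) :=
  prop_of_linearMap_exact S ((Ext.mk₀ X.g).postcompOfLinear R N (add_zero n))
    (hX.extClass.postcompOfLinear R N rfl) (fun x =>
      ⟨fun hx => Ext.covariant_sequence_exact₃ N hX x rfl hx, by rintro ⟨y, rfl⟩; simp⟩) h₂ h₁

lemma prop_ext_X₁ (hX : X.ShortExact) {n : ℕ} (h₃ : S (extModule n N X.X₃))
    (h₂ : S (extModule (n + 1) N X.X₂)) : S (extModule (n + 1) N X.X₁) :=
  prop_of_linearMap_exact S (hX.extClass.postcompOfLinear R N rfl)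
    ((Ext.mk₀ X.f).postcompOfLinear R N (add_zero (n + 1))) (fun x =>
      ⟨fun hx => Ext.covariant_sequence_exact₁ N hX x hx rfl, by rintro ⟨y, rfl⟩; simp⟩) h₃ h₂

lemma prop_ext_zero_of_mono {A B : ModuleCat.{u} R} (f : A ⟶ B) [Mono f]
    (h : S (extModule 0 N B)) : S (extModule 0 N A) := by
  let φ : extModule 0 N A ⟶ extModule 0 N B :=
    ModuleCat.ofHom ((Ext.mk₀ f).postcompOfLinear R N (add_zero 0))
  have : Mono φ := (ModuleCat.mono_iff_injective _).2 (Ext.postcomp_mk₀_injective_of_mono N f)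
  exact S.prop_of_mono φ h

end Serre

/-! ### Augmented complexes and coboundaries -/

section Complexes

variable {C : Type*} [Category* C] [Abelian C]

namespace CochainComplex

/-- The morphism between augmented cochain complexes given by a morphism of complexes and a
compatible morphism between the augmentation objects. -/
def augmentMap {K L : CochainComplex C ℕ} {X Y : C} {f : X ⟶ K.X 0} {g : Y ⟶ L.X 0}
    {hf : f ≫ K.d 0 1 = 0} {hg : g ≫ L.d 0 1 = 0} (φ : K ⟶ L) (ψ : X ⟶ Y)
    (h : f ≫ φ.f 0 = ψ ≫ g) : augment K f hf ⟶ augment L g hg where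
  f
    | 0 => ψ
    | n + 1 => φ.f n
  comm' := by
    rintro i j hij
    obtain rfl : i + 1 = j := hij
    cases i with
    | zero => exact h.symm
    | succ i => exact φ.comm i (i + 1)

instance mono_augmentMap {K L : CochainComplex C ℕ} {X Y : C} {f : X ⟶ K.X 0} {g : Y ⟶ L.X 0}
    {hf : f ≫ K.d 0 1 = 0} {hg : g ≫ L.d 0 1 = 0} (φ : K ⟶ L) (ψ : X ⟶ Y)
    (h : f ≫ φ.f 0 = ψ ≫ g) [∀ n, Mono (φ.f n)] [Mono ψ] :
    Mono (augmentMap (hf := hf) (hg := hg) φ ψ h) := by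
  have : ∀ n, Mono ((augmentMap (hf := hf) (hg := hg) φ ψ h).f n) := by
    rintro (_ | n)
    · assumption
    · exact inferInstanceAs (Mono (φ.f n))
  exact HomologicalComplex.mono_of_mono_f _ this

/-- Augmenting a cochain complex by the zero object shifts its homology by one. -/
lemma nonempty_homology_augment_zero_iso (K : CochainComplex C ℕ) {Z : C} (hZ : IsZero Z)
    (f : Z ⟶ K.X 0) (w : f ≫ K.d 0 1 = 0) (n : ℕ) :
    Nonempty ((augment K f w).homology (n + 1) ≅ K.homology n) := by
  let A := augment K f w
  let e := A.homologyIsoSc' n (n + 1) (n + 2) (by simp) (by simp)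
  cases n with
  | zero =>
    -- The predecessor of degree 0 is 0 by convention, with zero differential.
    let e' := K.homologyIsoSc' 0 0 1 (by simp) (by simp)
    let φ : K.sc' 0 0 1 ⟶ A.sc' 0 1 2 :=
      { τ₁ := 0
        τ₂ := 𝟙 (K.X 0)
        τ₃ := 𝟙 (K.X 1)
        comm₁₂ := zero_comp.trans
          ((Category.comp_id _).trans (K.shape 0 0 (by simp))).symm
        comm₂₃ := (Category.id_comp _).trans (Category.comp_id _).symm }
    have : Epi φ.τ₁ := hZ.epi _
    have : IsIso φ.τ₂ := inferInstanceAs (IsIso (𝟙 (K.X 0)))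
    have : Mono φ.τ₃ := inferInstanceAs (Mono (𝟙 (K.X 1)))
    have : IsIso (ShortComplex.homologyMap φ) :=
      ShortComplex.isIso_homologyMap_of_epi_of_isIso_of_mono φ
    exact ⟨e ≪≫ (asIso (ShortComplex.homologyMap φ)).symm ≪≫ e'.symm⟩
  | succ n =>
    exact ⟨e ≪≫ (K.homologyIsoSc' n (n + 1) (n + 2) (by simp) (by simp)).symm⟩

end CochainComplex

/-- The complex obtained by augmenting an injective resolution by the resolved object is
acyclic. -/
lemma CategoryTheory.InjectiveResolution.exactAt_augment {M : C} (I : InjectiveResolution M)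
    (n : ℕ) : (CochainComplex.augment I.cocomplex (X := M) (I.ι.f 0)
      I.ι_f_zero_comp_complex_d).ExactAt n := by
  match n with
  | 0 =>
    rw [HomologicalComplex.exactAt_iff' _ 0 0 1 (by simp) (by simp)]
    refine (ShortComplex.exact_iff_mono _ ?_).2 (inferInstanceAs (Mono (I.ι.f 0)))
    rfl
  | 1 =>
    rw [HomologicalComplex.exactAt_iff' _ 0 1 2 (by simp) (by simp)]
    exact ShortComplex.exact_of_f_is_kernel _ I.isLimitKernelFork
  | n + 2 =>
    rw [HomologicalComplex.exactAt_iff' _ (n + 1) (n + 2) (n + 3) (by simp) (by simp)]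
    exact I.exact_succ n

/-- For a cochain complex `A`, the object `kernel (A.pOpcycles (n + 1))` of coboundaries is the
cokernel of `H^n(A)` in the opcycles of degree `n`. -/
lemma CochainComplex.exists_shortExact_homology_opcycles (A : CochainComplex C ℕ) (n : ℕ) :
    ∃ (B : C) (f : A.homology n ⟶ A.opcycles n) (p : A.opcycles n ⟶ B) (i : B ⟶ A.X (n + 1))
      (q : A.X (n + 1) ⟶ A.opcycles (n + 1)) (w₁ : f ≫ p = 0) (w₂ : i ≫ q = 0),
      (ShortComplex.mk f p w₁).ShortExact ∧ (ShortComplex.mk i q w₂).ShortExact := by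
  have hw : A.fromOpcycles n (n + 1) ≫ A.pOpcycles (n + 1) = 0 := by
    rw [← cancel_epi (A.pOpcycles n)]; simp
  have hex : (ShortComplex.mk _ _ hw).Exact := by
    -- Replacing `d` by `fromOpcycles` only removes the epimorphism `pOpcycles n`.
    let φ : ShortComplex.mk _ _ (A.d_pOpcycles n (n + 1)) ⟶ ShortComplex.mk _ _ hw :=
      { τ₁ := A.pOpcycles n, τ₂ := 𝟙 _, τ₃ := 𝟙 _ }
    have : Epi φ.τ₁ := inferInstanceAs (Epi (A.pOpcycles n))
    have : IsIso φ.τ₂ := inferInstanceAs (IsIso (𝟙 _))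
    have : Mono φ.τ₃ := inferInstanceAs (Mono (𝟙 _))
    rw [← ShortComplex.exact_iff_of_epi_of_isIso_of_mono φ]
    exact ShortComplex.exact_of_g_is_cokernel _ (A.opcyclesIsCokernel n (n + 1) (by simp))
  have hepi : Epi (kernel.lift (A.pOpcycles (n + 1)) (A.fromOpcycles n (n + 1)) hw) :=
    (ShortComplex.exact_iff_epi_kernel_lift _).1 hex
  have hw₁ : A.homologyι n ≫ kernel.lift _ _ hw = 0 := by
    rw [← cancel_mono (kernel.ι _)]; simp
  refine ⟨kernel (A.pOpcycles (n + 1)), A.homologyι n, kernel.lift _ _ hw, kernel.ι _,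
    A.pOpcycles (n + 1), hw₁, kernel.condition _, ?_, ?_⟩
  · refine { exact := ?_, mono_f := inferInstanceAs (Mono (A.homologyι n)), epi_g := hepi }
    let φ : ShortComplex.mk _ _ hw₁ ⟶
        ShortComplex.mk _ _ (A.homologyι_comp_fromOpcycles n (n + 1)) :=
      { τ₁ := 𝟙 _, τ₂ := 𝟙 _, τ₃ := kernel.ι _ }
    have : Epi φ.τ₁ := inferInstanceAs (Epi (𝟙 _))
    have : IsIso φ.τ₂ := inferInstanceAs (IsIso (𝟙 _))
    have : Mono φ.τ₃ := inferInstanceAs (Mono (kernel.ι _))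
    rw [ShortComplex.exact_iff_of_epi_of_isIso_of_mono φ]
    exact ShortComplex.exact_of_f_is_kernel _ (A.homologyIsKernel n (n + 1) (by simp))
  · exact { exact := ShortComplex.exact_kernel _,
            mono_f := inferInstanceAs (Mono (kernel.ι _)),
            epi_g := inferInstanceAs (Epi (A.pOpcycles _)) }

end Complexes

/-! ### Dimension shifting along opcycles -/

section Serre

variable {R : Type u} [CommRing R] (S : ObjectProperty (ModuleCat.{u} R)) [S.IsSerreClass]
  {N : ModuleCat.{u} R} (A : CochainComplex (ModuleCat.{u} R) ℕ)

/-- If `Ext^p(N, A^n) = 0` for all `p` and all `n > 0`, then the cokernel `X₃` of `H^n(A)` in the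
opcycles of degree `n` satisfies: `Ext^0(N, X₃)` lies in `S`, and `Ext^{p+1}(N, X₃)` lies in `S` if
and only if `Ext^p(N, opcycles^{n+1})` does. -/
lemma exists_coboundaries
    (hA : ∀ n p, Subsingleton (extModule p N (A.X (n + 1)))) (n : ℕ) :
    ∃ X : ShortComplex (ModuleCat.{u} R), X.ShortExact ∧ X.X₁ = A.homology n ∧
      X.X₂ = A.opcycles n ∧ S (extModule 0 N X.X₃) ∧
      ∀ p, S (extModule (p + 1) N X.X₃) ↔ S (extModule p N (A.opcycles (n + 1))) := by
  obtain ⟨B, f, p, i, q, w₁, w₂, h₁, h₂⟩ := A.exists_shortExact_homology_opcycles n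
  have hz : ∀ p, S (extModule p N (A.X (n + 1))) := fun p =>
    have := hA n p
    prop_of_subsingleton S _
  have := h₂.mono_f
  exact ⟨_, h₁, rfl, rfl, prop_ext_zero_of_mono S i (hz 0), fun p =>
    ⟨fun h => prop_ext_X₃ S h₂ (hz p) h, fun h => prop_ext_X₁ S h₂ h (hz (p + 1))⟩⟩

variable (hA : ∀ n p, Subsingleton (extModule p N (A.X (n + 1))))

include hA

/-- `Ext^p(N, opcycles^n)` lies in `S` if all `Ext^{p-i}(N, H^{n+i}(A))` with `i ≤ p` do. -/
lemma prop_ext_opcycles (p n : ℕ)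
    (h : ∀ i ≤ p, S (extModule (p - i) N (A.homology (n + i)))) :
    S (extModule p N (A.opcycles n)) := by
  induction p generalizing n with
  | zero =>
    obtain ⟨X, hX, e₁, e₂, h0, -⟩ := exists_coboundaries S A hA n
    rw [← e₂]
    exact prop_ext_X₂ S hX (e₁ ▸ h 0 le_rfl) h0
  | succ p ih =>
    obtain ⟨X, hX, e₁, e₂, -, hs⟩ := exists_coboundaries S A hA n
    rw [← e₂]
    refine prop_ext_X₂ S hX (e₁ ▸ h 0 (Nat.zero_le _)) ((hs p).2 (ih _ fun i hi => ?_))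
    have := h (i + 1) (by lia)
    rwa [Nat.add_sub_add_right, ← Nat.add_assoc, Nat.add_right_comm] at this

/-- `Ext^s(N, H^{n+t}(A))` lies in `S` as soon as the abutment of the hypercohomology spectral
sequence and the sources and targets of the differentials to and from the corresponding entry
do. -/
lemma prop_ext_homology (s t n : ℕ) (h₁ : S (extModule (s + t) N (A.opcycles n)))
    (h₂ : ∀ i j, 1 ≤ i → i + j = t → S (extModule (s + 1 + i) N (A.homology (n + j))))
    (h₃ : ∀ i, 1 ≤ i → i + 1 ≤ s → S (extModule (s - 1 - i) N (A.homology (n + t + i)))) :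
    S (extModule s N (A.homology (n + t))) := by
  induction t generalizing n with
  | zero =>
    obtain ⟨X, hX, e₁, e₂, h0, hs⟩ := exists_coboundaries S A hA n
    change S (extModule s N (A.homology n))
    rw [← e₁]
    rw [Nat.add_zero, ← e₂] at h₁
    -- `Ext^{s-1}(N, X₃)` precedes `Ext^s(N, Hⁿ)`: absent for `s = 0`, `h0` for `s = 1`, then
    -- `Ext^{s-2}(N, Oⁿ⁺¹)`.
    match s with
    | 0 =>
      have := hX.mono_f
      exact prop_ext_zero_of_mono S X.f h₁
    | 1 => exact prop_ext_X₁ S hX h0 h₁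
    | s + 2 =>
      refine prop_ext_X₁ S hX ((hs s).2 (prop_ext_opcycles S A hA _ _ fun i hi => ?_)) h₁
      have := h₃ (i + 1) (by lia) (by lia)
      rwa [show s + 2 - 1 - (i + 1) = s - i by lia,
        show n + 0 + (i + 1) = n + 1 + i by lia] at this
  | succ t ih =>
    obtain ⟨X, hX, e₁, e₂, -, hs⟩ := exists_coboundaries S A hA n
    -- The obstruction to passing from `Oⁿ` to `Oⁿ⁺¹` lies in `Ext^{s+t+2}(N, Hⁿ)`, the case `i = t
    -- + 1` of `h₂`.
    have key : S (extModule (s + t) N (A.opcycles (n + 1))) := by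
      refine (hs _).1 (prop_ext_X₃ S hX (e₂ ▸ h₁) ?_)
      have := h₂ (t + 1) 0 (by lia) (by lia)
      rw [e₁]
      rwa [show s + 1 + (t + 1) = s + t + 1 + 1 by lia] at this
    have := ih (n + 1) key (fun i j hi hij => ?_) (fun i hi his => ?_)
    · rwa [Nat.add_right_comm] at this
    · have := h₂ i (j + 1) hi (by lia)
      rwa [show n + (j + 1) = n + 1 + j by lia] at this
    · have := h₃ i hi his
      rwa [show n + (t + 1) + i = n + 1 + t + i by lia] at this

end Serre

/-! ### The quotient complex and the conclusion -/

namespace SystemOfIdeals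

variable {R : Type u} [CommRing R] [IsNoetherianRing R] (Φ : SystemOfIdeals R)

open CochainComplex in
/-- There is a complex `A` with `A⁰ = M` whose cohomology is the local cohomology of `M` and such
that `Ext^p(N, Aⁿ) = 0` for every `n > 0` and every torsion module `N`. It is the quotient of an
augmented injective resolution of `M` by the torsion submodules of the injective terms. -/
lemma exists_complex (M : ModuleCat.{u} R) :
    ∃ A : CochainComplex (ModuleCat.{u} R) ℕ, Nonempty (M ≅ A.opcycles 0) ∧
      (∀ n, Nonempty (A.homology n ≅ (Φ.localCohomology n).obj M)) ∧
      ∀ N : ModuleCat.{u} R, Φ.IsTorsion N →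
        ∀ n p, Subsingleton (extModule p N (A.X (n + 1))) := by
  let I := injectiveResolution M
  let G := (Φ.torsionFunctor.mapHomologicalComplex (ComplexShape.up ℕ)).obj I.cocomplex
  let ι : G ⟶ I.cocomplex :=
    { f n := Φ.torsionι.app (I.cocomplex.X n)
      comm' i j _ := (Φ.torsionι.naturality (I.cocomplex.d i j)).symm }
  have : ∀ n, Mono (ι.f n) := fun n => inferInstanceAs (Mono (Φ.torsionι.app _))
  let Z : ModuleCat.{u} R := ModuleCat.of R PUnit
  have hZ : IsZero Z := ModuleCat.isZero_of_subsingleton Z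
  have : Mono (0 : Z ⟶ M) := hZ.mono _
  let φ := augmentMap (f := (0 : Z ⟶ G.X 0)) (g := (I.ι.f 0 : M ⟶ _)) (hf := zero_comp)
    (hg := I.ι_f_zero_comp_complex_d) ι (0 : Z ⟶ M) (zero_comp.trans zero_comp.symm)
  have : Mono φ := mono_augmentMap ι (0 : Z ⟶ M) _
  let X := ShortComplex.mk φ (cokernel.π φ) (cokernel.condition φ)
  have hX : X.ShortExact :=
    { exact := ShortComplex.exact_cokernel φ
      mono_f := inferInstanceAs (Mono φ)
      epi_g := inferInstanceAs (Epi (cokernel.π φ)) }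
  have hXn := (HomologicalComplex.shortExact_iff_degreewise_shortExact X).1 hX
  have hI : ∀ n, IsZero (X.X₂.homology n) := fun n => (I.exactAt_augment n).isZero_homology
  refine ⟨X.X₃, ?_, fun n => ?_, fun N hN n p => ?_⟩
  · have : IsIso (X.map (HomologicalComplex.eval _ _ 0)).g :=
      (hXn 0).isIso_g_iff.2 hZ
    exact ⟨@asIso _ _ _ _ (X.map (HomologicalComplex.eval _ _ 0)).g this ≪≫ X.X₃.opcycles₀Iso⟩
  -- The connecting map raises the degree by one; augmenting by zero lowers it back.
  · obtain ⟨e⟩ := nonempty_homology_augment_zero_iso G hZ 0 zero_comp n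
    exact ⟨hX.δIso n (n + 1) rfl (hI _) (hI _) ≪≫ e ≪≫
      (I.isoRightDerivedObj Φ.torsionFunctor n).symm⟩
  · have : Injective (X.map (HomologicalComplex.eval _ _ (n + 1))).X₁ :=
      inferInstanceAs (Injective (Φ.torsionFunctor.obj (I.cocomplex.X n)))
    have : Injective (X.map (HomologicalComplex.eval _ _ (n + 1))).X₂ :=
      inferInstanceAs (Injective (I.cocomplex.X n))
    have key := fun x : Abelian.Ext.{u} N _ p => ext_eq_zero_of_shortExact_of_injective
      (hXn (n + 1)) (fun f => Φ.exists_torsionι_factor hN f) x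
    exact ⟨fun x y => (key x).trans (key y).symm⟩

end SystemOfIdeals

theorem theorem2p8 {R : Type u} [CommRing R] [IsNoetherianRing R] (Φ : SystemOfIdeals R)
    (S : ObjectProperty (ModuleCat.{u} R)) [S.IsSerreClass]
    (N M : ModuleCat.{u} R) (hN : Φ.IsTorsion N) (s t : ℕ)
    (h₁ : S (extModule (s + t) N M))
    (h₂ : ∀ i : ℕ, 1 ≤ i → i ≤ t →
      S (extModule (s + 1 + i) N ((Φ.localCohomology (t - i)).obj M)))
    (h₃ : ∀ i : ℕ, 1 ≤ i → i + 1 ≤ s →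
      S (extModule (s - 1 - i) N ((Φ.localCohomology (t + i)).obj M))) :
    S (extModule s N ((Φ.localCohomology t).obj M)) := by
  obtain ⟨A, ⟨e⟩, hH, hA⟩ := Φ.exists_complex M
  have := prop_ext_homology S A (hA N hN) s t 0 (prop_extModule_of_iso S e h₁)
    (fun i j hi hij => ?_) (fun i hi his => ?_)
  · rw [Nat.zero_add] at this
    exact prop_extModule_of_iso S (hH t).some this
  · have := h₂ i hi (by lia)
    rw [show t - i = 0 + j by lia] at this
    exact prop_extModule_of_iso S (hH _).some.symm this
  · have := h₃ i hi his
    rw [← Nat.zero_add t] at this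
    exact prop_extModule_of_iso S (hH _).some.symm this
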